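/- Let $\mathcal C$ be a unitary premodular category: a semisimple $\mathbb C$-linear abelian rigid monoidal category with finitely many simple objects up to isomorphism, simple unit and finite-dimensional Hom spaces, with a compatible positive (C*-) dagger structure for which the associator, the unitors and the braiding are unitary, with duality morphisms normalised so that closing any endomorphism to the left or to the right gives the same value (the other cups and caps being the daggers of the given ones), and whose twists $\theta_X$ (the strand $X$ with a kink, i.e. the right partial trace of the braiding $c_{X,X}$) satisfy $\theta_{X\otimes Y}=(\theta_X\otimes\theta_Y)\,B_{X,Y}$. Here $B_{X,Y}=c_{Y,X}c_{X,Y}$ is the double braiding. Let $\operatorname{tr}$ be the (spherical) trace, $d_X=\operatorname{tr}(\mathrm{id}_X)$ the value of an $X$-labelled loop, $\mathcal D>0$ with $\mathcal D^2=\sum_c d_c^2$ (sums run over representatives of the isomorphism classes of simple objects), $S_{X,Y}=\frac1{\mathcal D}\operatorname{tr}(B_{X,\bar Y})$ with $\bar Y$ the dual of $Y$, and let the Müger center $\mathcal Z_2(\mathcal C)$ be the full subcategory of those $X$ with $B_{X,Y}=\mathrm{id}_{X\otimes Y}$ for all $Y\in\mathcal C$. For objects $A,X$ let $L_A(X)\in\operatorname{End}(X)$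 be the diagram of an $A$-loop encircling the strand $X$, i.e. the left partial trace over $A$ of $B_{A,X}$. (i) For all simple $a,b$, $$L_a(b)=\frac{S_{a,\bar b}}{S_{1,\bar b}}\,\mathrm{id}_b=\frac{\mathcal D\,S_{a,\bar b}}{d_b}\,\mathrm{id}_b .$$ (ii) For all simple $x,y$, and for every choice, for each simple $z$, of a basis $(v_{z,\mu})_\mu$ of $\operatorname{Hom}(x\otimes y,z)$ normalised by $v_{z,\nu}v_{z,\mu}^\dagger=\delta_{\mu\nu}\sqrt{d_xd_y/d_z}\;\mathrm{id}_z$, $$\frac1{\mathcal D^2}\sum_a d_a\,L_a(x\otimes y)=\sum_{z\in\mathcal Z_2(\mathcal C)}\ \sum_\mu\sqrt{\frac{d_z}{d_xd_y}}\;v_{z,\mu}^\dagger v_{z,\mu},$$ where on the right $z$ runs over the simple objects in the Müger center; that is, averaging $a$-loops with weights $d_a/\mathcal D^2$ around the two strands $x,y$ projects the pair onto the fusion channels $z$ that lie in the Müger center. -/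

import Mathlib

open CategoryTheory MonoidalCategory Limits

universe v u

namespace Premodular

/-- A complex-linear dagger category with the positivity of a C*-category: the dagger is a
conjugate-linear involutive contravariant endofunctor, fixing objects, and `f† ∘ f` is a positive
element of the endomorphism algebra of the source of `f`, which vanishes only for `f = 0`. (When
the spaces of morphisms are finite dimensional, this is the algebraic form of a C*-category.) -/
class CStarCategory (C : Type u) [Category.{v} C] [Preadditive C] [Linear ℂ C] where
  /-- The adjoint of a morphism. -/
  dag : ∀ {X Y : C}, (X ⟶ Y) → (Y ⟶ X)
  dag_dag : ∀ {X Y : C} (f : X ⟶ Y), dag (dag f) = f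
  dag_id : ∀ X : C, dag (𝟙 X) = 𝟙 X
  dag_comp : ∀ {X Y Z : C} (f : X ⟶ Y) (g : Y ⟶ Z), dag (f ≫ g) = dag g ≫ dag f
  dag_add : ∀ {X Y : C} (f g : X ⟶ Y), dag (f + g) = dag f + dag g
  dag_smul : ∀ {X Y : C} (c : ℂ) (f : X ⟶ Y), dag (c • f) = (starRingEnd ℂ c) • dag f
  dag_definite : ∀ {X Y : C} (f : X ⟶ Y), f ≫ dag f = 0 → f = 0
  dag_pos : ∀ {X Y : C} (f : X ⟶ Y), ∃ g : X ⟶ X, f ≫ dag f = g ≫ dag g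

open CStarCategory

/-- A unitary spherical fusion category: a semisimple complex-linear abelian monoidal category with
duals, finite-dimensional spaces of morphisms, finitely many simple objects up to isomorphism and
simple unit, together with a compatible C*-structure. The chosen dual `Xᘁ` of an object comes with
`η_ X Xᘁ : 𝟙_ C ⟶ X ⊗ Xᘁ` and `ε_ X Xᘁ : Xᘁ ⊗ X ⟶ 𝟙_ C`; the cap on `X ⊗ Xᘁ` and the cup on
`Xᘁ ⊗ X` are the adjoints of these. The field `spherical` says that closing a diagram on the right
or on the left gives the same value. -/
class UnitaryFusionCategory (C : Type u) [Category.{v} C] [Abelian C] [Linear ℂ C]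
    [MonoidalCategory C] [MonoidalPreadditive C] [MonoidalLinear ℂ C] [RightRigidCategory C]
    extends CStarCategory C where
  finiteDimensional_hom : ∀ X Y : C, FiniteDimensional ℂ (X ⟶ Y)
  simple_unit : Simple (𝟙_ C)
  semisimple : ∀ X : C, ∃ (n : ℕ) (Y : Fin n → C) (b : Bicone Y),
    (∀ i, Simple (Y i)) ∧ Nonempty b.IsBilimit ∧ Nonempty (X ≅ b.pt)
  finite_simples : ∃ (n : ℕ) (T : Fin n → C), ∀ X : C, Simple X → ∃ i, Nonempty (X ≅ T i)
  dag_tensor : ∀ {X Y X' Y' : C} (f : X ⟶ Y) (g : X' ⟶ Y'), dag (f ⊗ₘ g) = dag f ⊗ₘ dag g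
  dag_associator : ∀ X Y Z : C, dag (α_ X Y Z).hom = (α_ X Y Z).inv
  dag_leftUnitor : ∀ X : C, dag (λ_ X).hom = (λ_ X).inv
  dag_rightUnitor : ∀ X : C, dag (ρ_ X).hom = (ρ_ X).inv
  spherical : ∀ {X : C} (f : X ⟶ X),
    η_ X Xᘁ ≫ f ▷ Xᘁ ≫ dag (η_ X Xᘁ) = dag (ε_ X Xᘁ) ≫ Xᘁ ◁ f ≫ ε_ X Xᘁ

attribute [instance] UnitaryFusionCategory.finiteDimensional_hom UnitaryFusionCategory.simple_unit

/-- `S` lists the simple objects, each isomorphism class exactly once. -/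
structure IsSimpleSkeleton {C : Type u} [Category.{v} C] [Abelian C] {ι : Type*} (S : ι → C) :
    Prop where
  simple : ∀ i, Simple (S i)
  eq_of_iso : ∀ i j, Nonempty (S i ≅ S j) → i = j
  exists_iso : ∀ X : C, Simple X → ∃ i, Nonempty (X ≅ S i)

section Fusion

variable {C : Type u} [Category.{v} C] [Abelian C] [Linear ℂ C]
  [MonoidalCategory C] [MonoidalPreadditive C] [MonoidalLinear ℂ C] [RightRigidCategory C]
  [UnitaryFusionCategory C]

/-- The number represented by a closed diagram: the `c` with `c • 𝟙 = f`. -/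
noncomputable def scalar (f : 𝟙_ C ⟶ 𝟙_ C) : ℂ :=
  (endomorphism_simple_eq_smul_id ℂ f).choose

theorem scalar_smul_id (f : 𝟙_ C ⟶ 𝟙_ C) : scalar f • 𝟙 (𝟙_ C) = f :=
  (endomorphism_simple_eq_smul_id ℂ f).choose_spec

/-- The (spherical) trace of an endomorphism, obtained by closing its strand to a loop. -/
noncomputable def tr {X : C} (f : X ⟶ X) : ℂ :=
  scalar (η_ X Xᘁ ≫ f ▷ Xᘁ ≫ dag (η_ X Xᘁ))

/-- The quantum dimension `d_X`: the value of a loop labelled by `X`. This value is self-adjoint,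
hence a real number. -/
noncomputable def qdim (X : C) : ℝ := (tr (𝟙 X)).re

/-- The total quantum dimension `𝒟`, the positive number with `𝒟 ^ 2 = ∑ c, d_c ^ 2`. -/
noncomputable def totalDim {ι : Type*} [Fintype ι] (S : ι → C) : ℝ :=
  Real.sqrt (∑ i, qdim (S i) ^ 2)

variable [BraidedCategory C]

/-- The double braiding `B_{X,Y}`. -/
def doubleBraiding (X Y : C) : X ⊗ Y ⟶ X ⊗ Y := (β_ X Y).hom ≫ (β_ Y X).hom

/-- The twist of `X`: the strand `X` with a kink, that is, the right partial trace of the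
braiding of `X` with itself. -/
def twist (X : C) : X ⟶ X :=
  (ρ_ X).inv ≫ X ◁ η_ X Xᘁ ≫ (α_ X X Xᘁ).inv ≫ (β_ X X).hom ▷ Xᘁ ≫ (α_ X X Xᘁ).hom ≫
    X ◁ dag (η_ X Xᘁ) ≫ (ρ_ X).hom

variable (C) in
/-- A unitary premodular category: a unitary braided spherical fusion category whose twists obey
the ribbon equation. -/
class IsPremodular : Prop where
  dag_braiding : ∀ X Y : C, dag (β_ X Y).hom = (β_ X Y).inv
  ribbon : ∀ X Y : C, twist (X ⊗ Y) = doubleBraiding X Y ≫ (twist X ⊗ₘ twist Y)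

/-- The objects of the Müger center. -/
def mugerCenter : ObjectProperty C := fun X => ∀ Y : C, doubleBraiding X Y = 𝟙 (X ⊗ Y)

/-- The S-matrix, `S_{X,Y} = tr (B_{X,Y*}) / 𝒟`. Here `S` lists the simple objects. -/
noncomputable def sMatrix {ι : Type*} [Fintype ι] (S : ι → C) (X Y : C) : ℂ :=
  1 / (totalDim S : ℂ) * tr (doubleBraiding X Yᘁ)

/-- A loop labelled by `A` encircling the strand `X`: create `Aᘁ ⊗ A` to the left of `X`, move `A`
once around `X`, and annihilate. The strand `X` may be a bundle, such as `X = Y ⊗ Z`. -/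
def encircle (A X : C) : X ⟶ X :=
  (λ_ X).inv ≫ dag (ε_ A Aᘁ) ▷ X ≫ (α_ Aᘁ A X).hom ≫ Aᘁ ◁ doubleBraiding A X ≫
    (α_ Aᘁ A X).inv ≫ ε_ A Aᘁ ▷ X ≫ (λ_ X).hom

/-- A family of bases `v z` of the fusion spaces `X ⊗ Y ⟶ S z`, with the normalization
`v_ν ∘ v_μ† = δ_{μν} √(d_X d_Y / d_z)`. -/
def IsNormalized {ι : Type*} (S : ι → C) (X Y : C) {κ : ι → Type*}
    (v : ∀ z, Module.Basis (κ z) ℂ (X ⊗ Y ⟶ S z)) : Prop :=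
  ∀ z, (∀ μ, dag (v z μ) ≫ v z μ =
      (Real.sqrt (qdim X * qdim Y / qdim (S z)) : ℂ) • 𝟙 (S z)) ∧
    ∀ μ ν, μ ≠ ν → dag (v z μ) ≫ v z ν = 0

end Fusion

end Premodular

namespace Premodular
open CStarCategory

/-! ### Additive consequences of the dagger axioms. -/

section Dagger

variable {C : Type u} [Category.{v} C] [Preadditive C] [Linear ℂ C] [CStarCategory C]

/-! By Schur's lemma a loop around a simple strand `z` is a scalar, and taking traces identifies it
as `tr (doubleBraiding A z) / qdim z` (`encircle_eq_smul`). This is (i), once the double dual of `b`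
is identified with `b`.

For (ii), write s_a = tr B_{a,z} and σ = ∑ d_a s_a. Loops are multiplicative, s_{b⊗a} d_z = s_b s_a;
expanding b ⊗ a into simples and applying Frobenius reciprocity to the multiplicities gives s_b σ =
d_b d_z σ (`tr_doubleBraiding_mul_sum`). If σ ≠ 0, then tr B_{b,z} = tr 1 for all simple b, and
unitarity of B together with faithfulness of the trace forces B_{b,z} = 1, so z lies in the Müger
center. Hence σ vanishes off the center, while on it σ = 𝒟² d_z. So the averaged loop is 1 or 0 on
each simple object. Being natural in the encircled strand (`comp_encircle`), it slides through the
fusion vertices in the resolution of the identity of x ⊗ y (`sum_normalized_eq_id`).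

The longer half of the work is the trace itself. Sphericality is given only for endomorphisms and
the chosen duals, so cyclicity, independence of the dual and multiplicativity must be derived. The
key is that transposes of unitaries are unitary (`mate_comp_dag_of_unitary`), a positivity argument.
It makes the trace independent of the spherical pairing, hence multiplicative (`tr_tensor`); through
a Cayley transform it makes transposition commute with the dagger (`IsSpherical.mate_dag`), whence
cyclicity (`tr_comp_comm`). -/

theorem dag_zero (X Y : C) : dag (0 : X ⟶ Y) = 0 := by
  simpa using dag_smul (0 : ℂ) (0 : X ⟶ Y)

theorem dag_neg {X Y : C} (f : X ⟶ Y) : dag (-f) = -dag f := by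
  simpa using dag_smul (-1 : ℂ) f

theorem dag_sub {X Y : C} (f g : X ⟶ Y) : dag (f - g) = dag f - dag g := by
  rw [sub_eq_add_neg, dag_add, dag_neg, sub_eq_add_neg]

theorem dag_injective {X Y : C} {f g : X ⟶ Y} (h : dag f = dag g) : f = g := by
  rw [← dag_dag f, h, dag_dag]

end Dagger

/-! ### Transposes with respect to arbitrary exact pairings. -/

section Mate

variable {C : Type u} [Category.{v} C] [MonoidalCategory C]

/-- The transpose of a morphism with respect to two exact pairings. -/
def mate (X X' Y Y' : C) [ExactPairing X X'] [ExactPairing Y Y'] (f : X ⟶ Y) : Y' ⟶ X' :=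
  (ρ_ _).inv ≫ Y' ◁ η_ X X' ≫ Y' ◁ f ▷ X' ≫ (α_ _ _ _).inv ≫ ε_ Y Y' ▷ X' ≫ (λ_ _).hom

variable {X X' Y Y' Z Z' : C} [ExactPairing X X'] [ExactPairing Y Y'] [ExactPairing Z Z']

theorem coevaluation_comp_mate (f : X ⟶ Y) :
    η_ Y Y' ≫ Y ◁ mate X X' Y Y' f = η_ X X' ≫ f ▷ X' :=
  @coevaluation_comp_rightAdjointMate C _ _ X Y ⟨X'⟩ ⟨Y'⟩ f

theorem mate_comp_evaluation (f : X ⟶ Y) :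
    mate X X' Y Y' f ▷ X ≫ ε_ X X' = Y' ◁ f ≫ ε_ Y Y' :=
  @rightAdjointMate_comp_evaluation C _ _ X Y ⟨X'⟩ ⟨Y'⟩ f

theorem mate_comp (f : X ⟶ Y) (g : Y ⟶ Z) :
    mate X X' Z Z' (f ≫ g) = mate Y Y' Z Z' g ≫ mate X X' Y Y' f :=
  @comp_rightAdjointMate C _ _ X Y Z ⟨X'⟩ ⟨Y'⟩ ⟨Z'⟩ f g

theorem mate_id : mate X X' X X' (𝟙 X) = 𝟙 X' := @rightAdjointMate_id C _ _ X ⟨X'⟩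

/-- A morphism out of a dual is determined by its composite with the coevaluation. -/
theorem coevaluation_whiskerLeft_injective {W : C} {f g : Y' ⟶ W}
    (h : η_ Y Y' ≫ Y ◁ f = η_ Y Y' ≫ Y ◁ g) : f = g := by
  have := (tensorLeftHomEquiv (𝟙_ C) Y Y' W).injective
    (a₁ := (ρ_ Y').hom ≫ f) (a₂ := (ρ_ Y').hom ≫ g) (by
      simp only [tensorLeftHomEquiv, Equiv.coe_fn_mk, MonoidalCategory.whiskerLeft_comp]
      have e : ∀ k : Y' ⟶ W, (λ_ (𝟙_ C)).inv ≫ η_ Y Y' ▷ 𝟙_ C ≫ (α_ Y Y' (𝟙_ C)).hom ≫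
          Y ◁ (ρ_ Y').hom ≫ Y ◁ k = η_ Y Y' ≫ Y ◁ k := fun k => by monoidal
      rw [e, e, h])
  simpa using this

/-- A morphism into an object is determined by its composite with the coevaluation. -/
theorem coevaluation_whiskerRight_injective {W : C} {f g : Y ⟶ W}
    (h : η_ Y Y' ≫ f ▷ Y' = η_ Y Y' ≫ g ▷ Y') : f = g := by
  have := (tensorRightHomEquiv (𝟙_ C) Y Y' W).injective
    (a₁ := (λ_ Y).hom ≫ f) (a₂ := (λ_ Y).hom ≫ g) (by
      simp only [tensorRightHomEquiv, Equiv.coe_fn_mk, comp_whiskerRight]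
      have e : ∀ k : Y ⟶ W, (ρ_ (𝟙_ C)).inv ≫ 𝟙_ C ◁ η_ Y Y' ≫ (α_ (𝟙_ C) Y Y').inv ≫
          (λ_ Y).hom ▷ Y' ≫ k ▷ Y' = η_ Y Y' ≫ k ▷ Y' := fun k => by monoidal
      rw [e, e, h])
  simpa using this

theorem mate_surjective (F : Y' ⟶ X') : ∃ f : X ⟶ Y, mate X X' Y Y' f = F := by
  -- The preimage bends the `X'` leg of `η_ Y Y' ≫ Y ◁ F` back up to an input `X`.
  refine ⟨(λ_ X).inv ≫ ((tensorRightHomEquiv (𝟙_ C) X X' Y).symm (η_ Y Y' ≫ Y ◁ F)), ?_⟩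
  apply coevaluation_whiskerLeft_injective (Y := Y)
  rw [coevaluation_comp_mate]
  have h := (tensorRightHomEquiv (𝟙_ C) X X' Y).apply_symm_apply (η_ Y Y' ≫ Y ◁ F)
  refine Eq.trans ?_ h
  generalize (tensorRightHomEquiv (𝟙_ C) X X' Y).symm (η_ Y Y' ≫ Y ◁ F) = k
  simp only [tensorRightHomEquiv, Equiv.coe_fn_mk]
  monoidal

end Mate

section MateLinear
variable {C : Type u} [Category.{v} C] [Preadditive C] [MonoidalCategory C]
  [MonoidalPreadditive C] {X X' Y Y' : C} [ExactPairing X X'] [ExactPairing Y Y']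

theorem mate_add (f g : X ⟶ Y) :
    mate X X' Y Y' (f + g) = mate X X' Y Y' f + mate X X' Y Y' g := by
  simp [mate, MonoidalPreadditive.add_whiskerRight, MonoidalPreadditive.whiskerLeft_add]

theorem mate_smul [Linear ℂ C] [MonoidalLinear ℂ C] (c : ℂ) (f : X ⟶ Y) :
    mate X X' Y Y' (c • f) = c • mate X X' Y Y' f := by
  simp [mate]

end MateLinear

/-! ### Dagger versus tensor product, and positivity of closed diagrams. -/

section Fusion

variable {C : Type u} [Category.{v} C] [Abelian C] [Linear ℂ C]
  [MonoidalCategory C] [MonoidalPreadditive C] [MonoidalLinear ℂ C] [RightRigidCategory C]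
  [UnitaryFusionCategory C]

theorem dag_whiskerLeft (X : C) {Y Z : C} (f : Y ⟶ Z) : dag (X ◁ f) = X ◁ dag f := by
  rw [← id_tensorHom, UnitaryFusionCategory.dag_tensor, dag_id, id_tensorHom]

theorem dag_whiskerRight {Y Z : C} (f : Y ⟶ Z) (X : C) : dag (f ▷ X) = dag f ▷ X := by
  rw [← tensorHom_id, UnitaryFusionCategory.dag_tensor, dag_id, tensorHom_id]

theorem dag_associator_inv (X Y Z : C) : dag (α_ X Y Z).inv = (α_ X Y Z).hom := by
  rw [← UnitaryFusionCategory.dag_associator, dag_dag]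

theorem dag_leftUnitor_inv (X : C) : dag (λ_ X).inv = (λ_ X).hom := by
  rw [← UnitaryFusionCategory.dag_leftUnitor, dag_dag]

theorem dag_rightUnitor_inv (X : C) : dag (ρ_ X).inv = (ρ_ X).hom := by
  rw [← UnitaryFusionCategory.dag_rightUnitor, dag_dag]

theorem scalar_eq_of_smul_id_eq {f : 𝟙_ C ⟶ 𝟙_ C} {c : ℂ} (h : c • 𝟙 (𝟙_ C) = f) :
    scalar f = c := by
  have h2 := (scalar_smul_id f).trans h.symm
  exact smul_left_injective ℂ (id_nonzero (𝟙_ C)) h2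

theorem scalar_injective {f g : 𝟙_ C ⟶ 𝟙_ C} (h : scalar f = scalar g) : f = g := by
  rw [← scalar_smul_id f, h, scalar_smul_id]

theorem scalar_add (f g : 𝟙_ C ⟶ 𝟙_ C) : scalar (f + g) = scalar f + scalar g :=
  scalar_eq_of_smul_id_eq (by rw [add_smul, scalar_smul_id, scalar_smul_id])

theorem scalar_smul (c : ℂ) (f : 𝟙_ C ⟶ 𝟙_ C) : scalar (c • f) = c * scalar f :=
  scalar_eq_of_smul_id_eq (by rw [mul_smul, scalar_smul_id])

theorem scalar_dag (f : 𝟙_ C ⟶ 𝟙_ C) : scalar (dag f) = starRingEnd ℂ (scalar f) :=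
  scalar_eq_of_smul_id_eq (by
    conv_rhs => rw [← scalar_smul_id f, dag_smul, dag_id])

theorem scalar_zero : scalar (0 : 𝟙_ C ⟶ 𝟙_ C) = 0 :=
  scalar_eq_of_smul_id_eq (by simp)

theorem scalar_comp_dag (g : 𝟙_ C ⟶ 𝟙_ C) : scalar (g ≫ dag g) = (‖scalar g‖ ^ 2 : ℝ) := by
  apply scalar_eq_of_smul_id_eq
  conv_rhs => rw [← scalar_smul_id g, dag_smul, dag_id]
  rw [Linear.smul_comp, Linear.comp_smul, Category.comp_id, smul_smul, Complex.mul_conj']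
  push_cast; rfl

/-- The axiom `dag_pos` replaces `w` by an endomorphism of the unit, that is, by a complex number,
whose squared modulus appears. -/
theorem scalar_comp_dag_nonneg {W : C} (w : 𝟙_ C ⟶ W) : 0 ≤ (scalar (w ≫ dag w)).re := by
  obtain ⟨g, hg⟩ := dag_pos w
  rw [hg, scalar_comp_dag, Complex.ofReal_re]
  positivity

theorem scalar_comp_dag_im {W : C} (w : 𝟙_ C ⟶ W) : (scalar (w ≫ dag w)).im = 0 := by
  obtain ⟨g, hg⟩ := dag_pos w
  rw [hg, scalar_comp_dag, Complex.ofReal_im]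

theorem eq_zero_of_scalar_comp_dag {W : C} (w : 𝟙_ C ⟶ W) (h : (scalar (w ≫ dag w)).re = 0) :
    w = 0 := by
  apply dag_definite
  apply scalar_injective
  rw [scalar_zero]
  exact Complex.ext h (scalar_comp_dag_im w)

/-- A pairing is spherical if closing a strand to the right, or to the left, gives the same
value. -/
def IsSpherical (X X' : C) [ExactPairing X X'] : Prop := ∀ f : X ⟶ X,
  η_ X X' ≫ f ▷ X' ≫ dag (η_ X X') = dag (ε_ X X') ≫ X' ◁ f ≫ ε_ X X'

theorem isSpherical_rightDual (X : C) : IsSpherical X Xᘁ :=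
  UnitaryFusionCategory.spherical

/-! ### Loops as faithful positive functionals. -/

section Loop

variable (X X' : C) [ExactPairing X X']

/-- The value of a closed diagram consisting of a loop and an endomorphism of the strand. -/
noncomputable def loop : (X ⟶ X) →ₗ[ℂ] ℂ where
  toFun f := scalar (η_ X X' ≫ f ▷ X' ≫ dag (η_ X X'))
  map_add' f g := by
    simp [MonoidalPreadditive.add_whiskerRight, scalar_add]
  map_smul' c f := by simp [scalar_smul]

/-- The value of a loop with an endomorphism of the dual strand. -/
noncomputable def dualLoop : (X' ⟶ X') →ₗ[ℂ] ℂ where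
  toFun f := scalar (η_ X X' ≫ X ◁ f ≫ dag (η_ X X'))
  map_add' f g := by
    simp [MonoidalPreadditive.whiskerLeft_add, scalar_add]
  map_smul' c f := by simp [scalar_smul]

theorem loop_apply (f : X ⟶ X) : loop X X' f = scalar (η_ X X' ≫ f ▷ X' ≫ dag (η_ X X')) := rfl

theorem dualLoop_apply (f : X' ⟶ X') :
    dualLoop X X' f = scalar (η_ X X' ≫ X ◁ f ≫ dag (η_ X X')) := rfl

/-- Exhibits the loop as the squared norm of the bent morphism `η_ X X' ≫ f ▷ X'`. Since bending is
injective, positivity and faithfulness follow, with no sphericality needed. -/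
theorem loop_comp_dag {Y : C} (f : X ⟶ Y) :
    loop X X' (f ≫ dag f) = scalar ((η_ X X' ≫ f ▷ X') ≫ dag (η_ X X' ≫ f ▷ X')) := by
  simp [loop_apply, dag_comp, dag_whiskerRight]

theorem dualLoop_comp_dag {Y : C} (f : X' ⟶ Y) :
    dualLoop X X' (f ≫ dag f) = scalar ((η_ X X' ≫ X ◁ f) ≫ dag (η_ X X' ≫ X ◁ f)) := by
  simp [dualLoop_apply, dag_comp, dag_whiskerLeft]

theorem loop_comp_dag_nonneg {Y : C} (f : X ⟶ Y) : 0 ≤ (loop X X' (f ≫ dag f)).re := by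
  rw [loop_comp_dag]; exact scalar_comp_dag_nonneg _

theorem loop_comp_dag_im {Y : C} (f : X ⟶ Y) : (loop X X' (f ≫ dag f)).im = 0 := by
  rw [loop_comp_dag]; exact scalar_comp_dag_im _

theorem dualLoop_comp_dag_nonneg {Y : C} (f : X' ⟶ Y) :
    0 ≤ (dualLoop X X' (f ≫ dag f)).re := by
  rw [dualLoop_comp_dag]; exact scalar_comp_dag_nonneg _

theorem eq_zero_of_loop_comp_dag {Y : C} (f : X ⟶ Y) (h : (loop X X' (f ≫ dag f)).re = 0) :
    f = 0 := by
  rw [loop_comp_dag] at h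
  have := eq_zero_of_scalar_comp_dag _ h
  apply coevaluation_whiskerRight_injective (Y' := X')
  rw [this]; simp

theorem eq_zero_of_dualLoop_comp_dag {Y : C} (f : X' ⟶ Y)
    (h : (dualLoop X X' (f ≫ dag f)).re = 0) : f = 0 := by
  rw [dualLoop_comp_dag] at h
  have := eq_zero_of_scalar_comp_dag _ h
  apply coevaluation_whiskerLeft_injective (Y := X)
  rw [this]; simp

end Loop

/-! ### Transposes of unitaries, and independence of the trace from the chosen dual. -/

section Unitary

variable {X X' Y Y' : C} [ExactPairing X X'] [ExactPairing Y Y']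

theorem dag_coevaluation_comp_mate (f : Y ⟶ X) :
    f ▷ X' ≫ dag (η_ X X') = Y ◁ dag (mate X X' Y Y' (dag f)) ≫ dag (η_ Y Y') := by
  apply dag_injective
  rw [dag_comp, dag_comp, dag_whiskerLeft, dag_whiskerRight, dag_dag, dag_dag, dag_dag,
    coevaluation_comp_mate]

theorem dag_mate_comp_evaluation (f : X ⟶ Y) :
    dag (ε_ X X') ≫ X' ◁ f = dag (ε_ Y Y') ≫ dag (mate Y Y' X X' (dag f)) ▷ Y := by
  apply dag_injective
  rw [dag_comp, dag_comp, dag_whiskerLeft, dag_whiskerRight, dag_dag, dag_dag, dag_dag,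
    mate_comp_evaluation]

theorem dualLoop_mate_comp (f : Y ⟶ Y) (F : Y' ⟶ Y') :
    dualLoop Y Y' (mate Y Y' Y Y' f ≫ F) =
      scalar (η_ Y Y' ≫ f ▷ Y' ≫ Y ◁ F ≫ dag (η_ Y Y')) := by
  rw [dualLoop_apply, MonoidalCategory.whiskerLeft_comp, Category.assoc, ← Category.assoc,
    coevaluation_comp_mate, Category.assoc]

theorem dualLoop_mate (f : Y ⟶ Y) : dualLoop Y Y' (mate Y Y' Y Y' f) = loop Y Y' f := by
  simpa [loop_apply] using dualLoop_mate_comp (Y' := Y') f (𝟙 Y')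

/-- Every endomorphism of the dual is a transpose, so sphericality of the strand carries over to its
dual. -/
theorem IsSpherical.dualLoop_eq (hY : IsSpherical Y Y') (F : Y' ⟶ Y') :
    dualLoop Y Y' F = scalar (dag (ε_ Y Y') ≫ F ▷ Y ≫ ε_ Y Y') := by
  obtain ⟨f, rfl⟩ := mate_surjective (X := Y) (Y := Y) F
  rw [dualLoop_mate, mate_comp_evaluation, loop_apply, hY]

/-- Slides `u` through the cup and its adjoint through the cap of the right closure. -/
theorem loop_conj_eq_dualLoop (u : X ⟶ Y) (f : Y ⟶ Y) :
    loop X X' (u ≫ f ≫ dag u) =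
      dualLoop Y Y' (mate Y Y' Y Y' f ≫ mate X X' Y Y' u ≫ dag (mate X X' Y Y' u)) := by
  rw [dualLoop_mate_comp, loop_apply]
  congr 1
  have h := dag_coevaluation_comp_mate (X := X) (X' := X') (Y := Y) (Y' := Y') (dag u)
  rw [dag_dag] at h
  rw [comp_whiskerRight, comp_whiskerRight, Category.assoc, Category.assoc, h,
    ← Category.assoc, ← coevaluation_comp_mate (Y' := Y'), MonoidalCategory.whiskerLeft_comp]
  simp only [Category.assoc]
  rw [whisker_exchange_assoc]

/-- The same sliding on the left closure, where the transpose of `dag u` appears instead, and on the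
other side of `f`. Comparing both evaluations of one loop is what drives the unitarity argument. -/
theorem IsSpherical.loop_conj_eq_dualLoop (hX : IsSpherical X X') (hY : IsSpherical Y Y')
    (u : X ⟶ Y) (f : Y ⟶ Y) :
    loop X X' (u ≫ f ≫ dag u) =
      dualLoop Y Y' ((dag (mate Y Y' X X' (dag u)) ≫ mate Y Y' X X' (dag u)) ≫
        mate Y Y' Y Y' f) := by
  rw [hY.dualLoop_eq, loop_apply, hX]
  congr 1
  rw [MonoidalCategory.whiskerLeft_comp, MonoidalCategory.whiskerLeft_comp, Category.assoc,
    Category.assoc, ← mate_comp_evaluation (X' := Y'), ← Category.assoc, dag_mate_comp_evaluation (Y' := Y'),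
    comp_whiskerRight, comp_whiskerRight]
  simp only [Category.assoc]
  rw [mate_comp_evaluation (X := Y) (Y := Y), whisker_exchange_assoc]

/-- The transpose of a unitary with respect to spherical pairings is unitary. -/
theorem mate_comp_dag_of_unitary (hX : IsSpherical X X') (hY : IsSpherical Y Y')
    (u : X ⟶ Y) (h₁ : u ≫ dag u = 𝟙 X) (h₂ : dag u ≫ u = 𝟙 Y) :
    mate X X' Y Y' u ≫ dag (mate X X' Y Y' u) = 𝟙 Y' := by
  set T := mate X X' Y Y' u with hT
  set V := mate Y Y' X X' (dag u) with hV
  -- As `u` is unitary, `V` inverts `T`, so the positive elements `P` and `Q` below are mutually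
  -- inverse. The goal is `P = 1`.
  have hTV : T ≫ V = 𝟙 Y' := by rw [hT, hV, ← mate_comp, h₂, mate_id]
  set P := T ≫ dag T with hP
  set Q := dag V ≫ V with hQ
  have dP : dag P = P := by rw [hP, dag_comp, dag_dag]
  have dQ : dag Q = Q := by rw [hQ, dag_comp, dag_dag]
  have hVT : V ≫ T = 𝟙 X' := by rw [hT, hV, ← mate_comp, h₁, mate_id]
  have hPQ : P ≫ Q = 𝟙 Y' := by
    rw [hP, hQ, Category.assoc, ← Category.assoc (dag T), ← dag_comp, hVT, dag_id,
      Category.id_comp, hTV]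
  have hQP : Q ≫ P = 𝟙 Y' := by
    rw [hP, hQ, Category.assoc, ← Category.assoc V, hVT, Category.id_comp, ← dag_comp, hTV,
      dag_id]
  have key : ∀ F : Y' ⟶ Y', dualLoop Y Y' (F ≫ P) = dualLoop Y Y' (Q ≫ F) := by
    intro F
    obtain ⟨f, rfl⟩ := mate_surjective (X := Y) (Y := Y) F
    rw [hP, ← loop_conj_eq_dualLoop, hX.loop_conj_eq_dualLoop hY]
  -- With φ the loop functional, taking F = P and F = Q gives φ(P²) = φ(1) = φ(Q²), so φ((P − Q)²) =
  -- 0. Faithfulness yields P = Q, hence P² = 1.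
  have k1 := key P
  have k2 := key Q
  rw [hQP] at k1 k2
  have hPQ' : P = Q := by
    refine sub_eq_zero.1 (eq_zero_of_dualLoop_comp_dag Y Y' _ ?_)
    rw [dag_sub, dP, dQ, Preadditive.sub_comp, Preadditive.comp_sub, Preadditive.comp_sub,
      hPQ, hQP, map_sub, map_sub, map_sub, k1, ← k2]
    simp
  rw [← hPQ'] at hPQ
  -- An involution that is positive is 1: (1 − P)² = 2 − 2P and (1 − P)P(1 − P) = 2P − 2 are both
  -- positive and sum to zero.
  have e1 : (𝟙 Y' - P) ≫ dag (𝟙 Y' - P) = (2 : ℂ) • 𝟙 Y' - (2 : ℂ) • P := by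
    rw [dag_sub, dag_id, dP, two_smul, two_smul, Preadditive.sub_comp, Preadditive.comp_sub,
      Preadditive.comp_sub, hPQ]
    simp only [Category.comp_id, Category.id_comp]
    abel
  have e2 : ((𝟙 Y' - P) ≫ T) ≫ dag ((𝟙 Y' - P) ≫ T) = (2 : ℂ) • P - (2 : ℂ) • 𝟙 Y' := by
    rw [dag_comp, Category.assoc, ← Category.assoc T, ← hP, dag_sub, dag_id, dP, two_smul,
      two_smul, Preadditive.sub_comp, Preadditive.comp_sub, Preadditive.comp_sub,
      Preadditive.comp_sub, hPQ]
    simp only [Category.comp_id, Category.id_comp, hPQ]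
    abel
  have p1 := dualLoop_comp_dag_nonneg Y Y' (𝟙 Y' - P)
  have p2 := dualLoop_comp_dag_nonneg Y Y' ((𝟙 Y' - P) ≫ T)
  refine (sub_eq_zero.1 (eq_zero_of_dualLoop_comp_dag Y Y' (𝟙 Y' - P) ?_)).symm
  rw [e1, map_sub, Complex.sub_re] at *
  rw [e2, map_sub, Complex.sub_re] at p2
  linarith

theorem loop_conj_of_unitary (hX : IsSpherical X X') (hY : IsSpherical Y Y')
    (u : X ⟶ Y) (h₁ : u ≫ dag u = 𝟙 X) (h₂ : dag u ≫ u = 𝟙 Y) (f : Y ⟶ Y) :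
    loop X X' (u ≫ f ≫ dag u) = loop Y Y' f := by
  rw [loop_conj_eq_dualLoop (Y' := Y'), mate_comp_dag_of_unitary hX hY u h₁ h₂, Category.comp_id,
    dualLoop_mate]

/-- The identity of `X` is unitary, and its transpose between two pairings is the comparison of the
two duals. -/
theorem tr_eq_loop (f : X ⟶ X) (hX : IsSpherical X X') : tr f = loop X X' f := by
  have := loop_conj_of_unitary (isSpherical_rightDual X) hX (𝟙 X) (by simp [dag_id])
    (by simp [dag_id]) f
  simp only [dag_id, Category.comp_id, Category.id_comp] at this
  exact this

end Unitary

/-! ### Transposition commutes with the dagger; cyclicity on one object. -/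

section Traciality

variable {X X' : C} [ExactPairing X X']

/-- Composition with `w` is an injective linear endomorphism of the finite-dimensional algebra End
X, hence surjective. -/
theorem exists_inverse_of_comp_eq_zero (w : X ⟶ X) (h : ∀ {Y : C} (k : Y ⟶ X), k ≫ w = 0 → k = 0) :
    ∃ w', w' ≫ w = 𝟙 X ∧ w ≫ w' = 𝟙 X := by
  let R : (X ⟶ X) →ₗ[ℂ] (X ⟶ X) := Linear.rightComp ℂ X w
  have hR : Function.Injective R := by
    rw [← LinearMap.ker_eq_bot, LinearMap.ker_eq_bot']
    exact fun k hk => h k hk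
  obtain ⟨w', hw'⟩ := LinearMap.injective_iff_surjective.1 hR (𝟙 X)
  have hw : w' ≫ w = 𝟙 X := hw'
  refine ⟨w', hw, hR ?_⟩
  change (w ≫ w') ≫ w = 𝟙 X ≫ w
  rw [Category.assoc, hw, Category.comp_id, Category.id_comp]

theorem IsSpherical.mate_dag_of_selfAdjoint (hX : IsSpherical X X') (h : X ⟶ X) (hh : dag h = h) :
    dag (mate X X' X X' h) = mate X X' X X' h := by
  -- Cayley transform: for self-adjoint `h`, the element (1 + ih)⁻¹(1 − ih) is unitary, so the
  -- result on transposes of unitaries applies to it.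
  set w := 𝟙 X + Complex.I • h with hw
  have dw : dag w = 𝟙 X - Complex.I • h := by
    rw [hw, dag_add, dag_id, dag_smul, hh, Complex.conj_I, neg_smul, sub_eq_add_neg]
  have hcomm : w ≫ dag w = 𝟙 X + h ≫ h := by
    rw [dw, hw]
    simp only [smul_add, Preadditive.add_comp, Preadditive.comp_sub, Category.id_comp, Category.comp_id,
      Linear.smul_comp, Linear.comp_smul, smul_smul, Complex.I_mul_I, neg_smul, one_smul]
    abel
  have hcomm' : dag w ≫ w = 𝟙 X + h ≫ h := by
    rw [dw, hw]
    simp only [smul_sub, Preadditive.comp_add, Preadditive.sub_comp, Category.id_comp, Category.comp_id,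
      Linear.smul_comp, Linear.comp_smul, smul_smul, Complex.I_mul_I, neg_smul, one_smul]
    abel
  obtain ⟨w', h1, h2⟩ := exists_inverse_of_comp_eq_zero w (by
    intro Y k hk
    -- Invertibility of `w`: since w w† = 1 + h², a morphism killed by `w` has two positive terms
    -- summing to zero.
    have e : k ≫ dag k + (k ≫ h) ≫ dag (k ≫ h) = 0 := by
      calc _ = (k ≫ w) ≫ dag (k ≫ w) := by
            rw [dag_comp k w, Category.assoc k w, ← Category.assoc w (dag w), hcomm, dag_comp, hh]
            simp
        _ = 0 := by rw [hk, zero_comp]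
    have p1 := loop_comp_dag_nonneg Y Yᘁ k
    have p2 := loop_comp_dag_nonneg Y Yᘁ (k ≫ h)
    have e' := congrArg (fun f => (loop Y Yᘁ f).re) e
    simp only [map_add, Complex.add_re, map_zero, Complex.zero_re] at e'
    exact eq_zero_of_loop_comp_dag Y Yᘁ k (by linarith))
  have h1' : dag w ≫ dag w' = 𝟙 X := by rw [← dag_comp, h1, dag_id]
  have h2' : dag w' ≫ dag w = 𝟙 X := by rw [← dag_comp, h2, dag_id]
  set u := w' ≫ dag w with hu
  have du : dag u = w ≫ dag w' := by rw [hu, dag_comp, dag_dag]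
  have u1 : u ≫ dag u = 𝟙 X := by
    rw [du, hu, Category.assoc, ← Category.assoc (dag w), hcomm', ← hcomm, Category.assoc, h1',
      Category.comp_id, h1]
  have u2 : dag u ≫ u = 𝟙 X := by
    have : u ≫ (dag w' ≫ w) = 𝟙 X := by
      rw [hu, Category.assoc, ← Category.assoc (dag w), h1', Category.id_comp, h1]
    have v : (dag w' ≫ w) ≫ u = 𝟙 X := by
      rw [hu, Category.assoc, ← Category.assoc w, h2, Category.id_comp, h2']
    rw [show dag u = dag w' ≫ w by
      rw [← Category.id_comp (dag u), ← v, Category.assoc, u1, Category.comp_id], v]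
  have uw : u ≫ w = dag w := by
    rw [hu, Category.assoc, hcomm', ← hcomm, ← Category.assoc, h1, Category.id_comp]
  set H := mate X X' X X' h with hH
  have mW : mate X X' X X' w = 𝟙 X' + Complex.I • H := by
    rw [hw, mate_add, mate_id, mate_smul]
  have mW' : mate X X' X X' (dag w) = 𝟙 X' - Complex.I • H := by
    rw [dw, sub_eq_add_neg, ← neg_smul, mate_add, mate_id, mate_smul, neg_smul, sub_eq_add_neg]
  have hU := mate_comp_dag_of_unitary hX hX u u1 u2
  have hWU := mate_comp (X := X) (X' := X') (Y := X) (Y' := X') (Z := X) (Z' := X') u w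
  rw [uw, mW, mW'] at hWU
  -- Transposing u w = w† and cancelling the unitary transpose of `u` equates these two products.
  -- Expanding, the quadratic terms cancel and only H† = H remains.
  have hfin : (𝟙 X' - Complex.I • H) ≫ dag (𝟙 X' - Complex.I • H) =
      (𝟙 X' + Complex.I • H) ≫ dag (𝟙 X' + Complex.I • H) := by
    conv_lhs => rw [hWU]
    rw [dag_comp, Category.assoc, ← Category.assoc (mate X X' X X' u), hU, Category.id_comp]
  simp only [dag_sub, dag_add, dag_id, dag_smul, Complex.conj_I, Preadditive.add_comp,
    Preadditive.sub_comp, Preadditive.comp_add, Preadditive.comp_sub, Category.id_comp,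
    Category.comp_id, Linear.smul_comp, neg_smul] at hfin
  have : (2 * Complex.I) • (dag H - H) = 0 := by
    rw [← sub_eq_zero.2 hfin]
    module
  rcases smul_eq_zero.1 this with h0 | h0
  · simp at h0
  · exact sub_eq_zero.1 h0

theorem IsSpherical.mate_dag (hX : IsSpherical X X') (f : X ⟶ X) :
    mate X X' X X' (dag f) = dag (mate X X' X X' f) := by
  set h := f + dag f with hh
  set k := Complex.I • (dag f - f) with hk
  have dh : dag h = h := by rw [hh, dag_add, dag_dag, add_comm]
  have dk : dag k = k := by
    rw [hk, dag_smul, dag_sub, dag_dag, Complex.conj_I, neg_smul, ← smul_neg, neg_sub]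
  have ef : f = (1 / 2 : ℂ) • h + (Complex.I / 2) • k := by
    rw [hh, hk, smul_smul, show Complex.I / 2 * Complex.I = -(1 / 2) by
      linear_combination (1 / 2) * Complex.I_mul_I, neg_smul, ← smul_neg, ← smul_add]
    rw [show f + dag f + -(dag f - f) = (2 : ℂ) • f by rw [two_smul]; abel, smul_smul]
    norm_num
  have mh := hX.mate_dag_of_selfAdjoint h dh
  have mk := hX.mate_dag_of_selfAdjoint k dk
  rw [ef]
  simp only [dag_add, dag_smul, mate_add, mate_smul, mh, mk, dh, dk]

/-- The trace is cyclic on endomorphisms of a single object. -/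
theorem IsSpherical.loop_comp_comm (hX : IsSpherical X X') (f g : X ⟶ X) :
    loop X X' (f ≫ g) = loop X X' (g ≫ f) := by
  rw [loop_apply, comp_whiskerRight, Category.assoc, dag_coevaluation_comp_mate (X' := X')
    (Y' := X'), hX.mate_dag, dag_dag, ← dualLoop_mate_comp, ← mate_comp, dualLoop_mate]

end Traciality

end Fusion

section Fusion

variable {C : Type u} [Category.{v} C] [Abelian C] [Linear ℂ C]
  [MonoidalCategory C] [MonoidalPreadditive C] [MonoidalLinear ℂ C] [RightRigidCategory C]
  [UnitaryFusionCategory C]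

/-! ### Cyclicity of the trace between different objects. -/

section Trace

theorem tr_eq (X : C) (f : X ⟶ X) : tr f = loop X Xᘁ f := rfl

theorem tr_sub {X : C} (f g : X ⟶ X) : tr (f - g) = tr f - tr g := map_sub (loop X Xᘁ) f g

theorem tr_smul {X : C} (c : ℂ) (f : X ⟶ X) : tr (c • f) = c * tr f := map_smul (loop X Xᘁ) c f

theorem tr_sum {X : C} {κ : Type*} (s : Finset κ) (f : κ → (X ⟶ X)) :
    tr (∑ i ∈ s, f i) = ∑ i ∈ s, tr (f i) := map_sum (loop X Xᘁ) f s

theorem tr_dag {X : C} (f : X ⟶ X) : tr (dag f) = starRingEnd ℂ (tr f) := by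
  rw [tr, tr, ← scalar_dag, dag_comp, dag_comp, dag_dag, dag_whiskerRight, Category.assoc]

theorem tr_comp_dag_nonneg {X Y : C} (f : X ⟶ Y) : 0 ≤ (tr (f ≫ dag f)).re :=
  loop_comp_dag_nonneg X Xᘁ f

theorem tr_comp_dag {X Y : C} (f : X ⟶ Y) : tr (f ≫ dag f) = (tr (f ≫ dag f)).re :=
  Complex.ext rfl (loop_comp_dag_im X Xᘁ f)

theorem eq_zero_of_tr_comp_dag {X Y : C} (f : X ⟶ Y) (h : (tr (f ≫ dag f)).re = 0) : f = 0 :=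
  eq_zero_of_loop_comp_dag X Xᘁ f h

theorem tr_id (X : C) : tr (𝟙 X) = qdim X := by
  have := tr_comp_dag (𝟙 X)
  rw [dag_id, Category.comp_id] at this
  exact this

theorem qdim_nonneg (X : C) : 0 ≤ qdim X := by
  have := tr_comp_dag_nonneg (𝟙 X)
  rw [dag_id, Category.comp_id] at this
  exact this

theorem qdim_pos (X : C) [Simple X] : 0 < qdim X := by
  refine lt_of_le_of_ne (qdim_nonneg X) fun h => id_nonzero X ?_
  apply eq_zero_of_tr_comp_dag
  rw [dag_id, Category.comp_id]
  exact h.symm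

/-- The two slidings express the trace as κ d_c and as κ' d_c, where κ and κ' are scalars on the
dual of `c`. They agree because d_c ≠ 0, their product is 1, and positivity excludes −1. -/
theorem tr_comp_dag_of_isometry {X c : C} [Simple c] (p : X ⟶ c) (hp : dag p ≫ p = 𝟙 c) :
    tr (p ≫ dag p) = qdim c := by
  set b := mate X Xᘁ c cᘁ p with hb
  set a := mate c cᘁ X Xᘁ (dag p) with ha
  have hba : b ≫ a = 𝟙 cᘁ := by rw [hb, ha, ← mate_comp, hp, mate_id]
  have hab : dag (a ≫ b) = a ≫ b := by
    rw [hb, ha, ← mate_comp, ← (isSpherical_rightDual X).mate_dag, dag_comp, dag_dag]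
  have hF : ∀ F : cᘁ ⟶ cᘁ, ∃ z : ℂ, F = z • 𝟙 cᘁ := by
    intro F
    obtain ⟨f, rfl⟩ := mate_surjective (X := c) (Y := c) F
    obtain ⟨z, rfl⟩ := endomorphism_simple_eq_smul_id ℂ f
    exact ⟨z, by rw [mate_smul, mate_id]⟩
  obtain ⟨κ, hκ⟩ := hF (b ≫ dag b)
  obtain ⟨κ', hκ'⟩ := hF (dag a ≫ a)
  have h1 : tr (p ≫ dag p) = κ * qdim c := by
    have := loop_conj_eq_dualLoop (X' := Xᘁ) (Y' := cᘁ) p (𝟙 c)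
    rw [mate_id, Category.id_comp, Category.id_comp, ← hb, hκ, map_smul, ← mate_id (X := c), dualLoop_mate,
      ← tr_eq, ← tr_eq, tr_id] at this
    exact this
  have h2 : tr (p ≫ dag p) = κ' * qdim c := by
    have := (isSpherical_rightDual X).loop_conj_eq_dualLoop (isSpherical_rightDual c) p (𝟙 c)
    rw [mate_id, Category.id_comp, Category.comp_id, ← ha, hκ', map_smul, ← mate_id (X := c),
      dualLoop_mate, ← tr_eq, ← tr_eq, tr_id] at this
    exact this
  have hd : (qdim c : ℂ) ≠ 0 := by exact_mod_cast (qdim_pos c).ne'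
  have hne : 𝟙 cᘁ ≠ 0 := by
    intro h
    have := dualLoop_mate (Y' := cᘁ) (𝟙 c)
    rw [mate_id, h, map_zero, ← tr_eq, tr_id] at this
    exact hd this.symm
  -- The middle factor is the adjoint of `a ≫ b`, the transpose of the self-adjoint `p ≫ dag p`; it
  -- is therefore self-adjoint, and `b ≫ a = 𝟙` collapses the product.
  have hκκ : (κ * κ') • 𝟙 cᘁ = (1 : ℂ) • 𝟙 cᘁ := by
    calc _ = (b ≫ dag b) ≫ (dag a ≫ a) := by
          rw [hκ, hκ', Linear.smul_comp, Linear.comp_smul, smul_smul, Category.comp_id]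
      _ = b ≫ dag (a ≫ b) ≫ a := by rw [dag_comp]; simp
      _ = _ := by rw [hab, Category.assoc, hba, Category.comp_id, hba, one_smul]
  have hκκ' := smul_left_injective ℂ hne hκκ
  have hkk : κ = κ' := mul_right_cancel₀ hd (h1.symm.trans h2)
  rw [← hkk] at hκκ'
  rcases mul_self_eq_one_iff.1 hκκ' with h | h
  · rw [h1, h, one_mul]
  · have := tr_comp_dag_nonneg p
    rw [h1, h] at this
    have := qdim_pos c
    simp at *
    linarith

theorem exists_isometry {X c : C} [Simple c] (f : X ⟶ c) (hf : f ≠ 0) :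
    ∃ p : X ⟶ c, dag p ≫ p = 𝟙 c := by
  obtain ⟨z, hz⟩ := endomorphism_simple_eq_smul_id ℂ (dag f ≫ f)
  have h1 := tr_comp_dag (dag f)
  have h2 := tr_comp_dag_nonneg (dag f)
  have h3 : (tr (dag f ≫ dag (dag f))).re ≠ 0 := fun h => hf (by
    have := eq_zero_of_tr_comp_dag _ h
    rw [← dag_dag f, this, dag_zero])
  rw [dag_dag] at h1 h2 h3
  generalize (tr (dag f ≫ f)).re = r at *
  have hr : 0 < r := lt_of_le_of_ne h2 h3.symm
  have hc := qdim_pos c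
  rw [← hz, tr_smul, tr_id] at h1
  have hz' : z = ((r / qdim c : ℝ) : ℂ) := by
    have : (qdim c : ℂ) ≠ 0 := by exact_mod_cast hc.ne'
    push_cast
    field_simp
    exact h1
  have hs : 0 < r / qdim c := div_pos hr hc
  generalize r / qdim c = s at *
  refine ⟨((Real.sqrt s)⁻¹ : ℂ) • f, ?_⟩
  have e : ((Real.sqrt s : ℂ))⁻¹ * ((Real.sqrt s : ℂ)⁻¹ * z) = 1 := by
    have h4 : (Real.sqrt s : ℂ) * Real.sqrt s = s := by
      exact_mod_cast Real.mul_self_sqrt hs.le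
    have h5 : (s : ℂ) ≠ 0 := by exact_mod_cast hs.ne'
    rw [hz', ← mul_assoc, ← mul_inv, h4, inv_mul_cancel₀ h5]
  rw [dag_smul, Linear.smul_comp, Linear.comp_smul, ← hz, smul_smul, smul_smul, map_inv₀,
    Complex.conj_ofReal, mul_assoc, e, one_smul]

/-- Inserting `dag p ≫ p = 𝟙` makes both factors endomorphisms of `X`, where cyclicity is known.
After the swap `g ≫ f` is a scalar, and only the trace of `p ≫ dag p` is left. -/
theorem tr_comp_comm_of_simple {X c : C} [Simple c] (f : X ⟶ c) (g : c ⟶ X) :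
    tr (f ≫ g) = tr (g ≫ f) := by
  by_cases hf : f = 0
  · subst hf
    have h0 : ∀ W : C, tr (0 : W ⟶ W) = 0 := fun W => map_zero (loop W Wᘁ)
    rw [zero_comp, comp_zero, h0, h0]
  obtain ⟨p, hp⟩ := exists_isometry f hf
  obtain ⟨z, hz⟩ := endomorphism_simple_eq_smul_id ℂ (g ≫ f)
  calc tr (f ≫ g) = tr ((f ≫ dag p) ≫ (p ≫ g)) := by
        rw [Category.assoc, ← Category.assoc (dag p), hp, Category.id_comp]
    _ = tr ((p ≫ g) ≫ (f ≫ dag p)) := (isSpherical_rightDual X).loop_comp_comm _ _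
    _ = tr (z • (p ≫ dag p)) := by
        rw [Category.assoc, ← Category.assoc g, ← hz]
        simp
    _ = _ := by rw [tr_smul, tr_comp_dag_of_isometry p hp, ← hz, tr_smul, tr_id]

/-- A decomposition of an object into simple summands. -/
structure SimpleDecomposition (X : C) where
  n : ℕ
  summand : Fin n → C
  π : ∀ i, X ⟶ summand i
  incl : ∀ i, summand i ⟶ X
  simple : ∀ i, Simple (summand i)
  incl_π_self : ∀ i, incl i ≫ π i = 𝟙 _
  incl_π_ne : ∀ i j, i ≠ j → incl i ≫ π j = 0
  total : ∑ i, π i ≫ incl i = 𝟙 X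

theorem nonempty_simpleDecomposition (X : C) : Nonempty (SimpleDecomposition X) := by
  obtain ⟨n, Y, b, hY, ⟨hb⟩, ⟨e⟩⟩ := UnitaryFusionCategory.semisimple X
  refine ⟨⟨n, Y, fun i => e.hom ≫ b.π i, fun i => b.ι i ≫ e.inv, hY, fun i => by simp,
    fun i j h => by simp [bicone_ι_π_ne b h], ?_⟩⟩
  have := IsBilimit.total hb
  calc _ = e.hom ≫ (∑ i, b.π i ≫ b.ι i) ≫ e.inv := by
        simp [Preadditive.comp_sum, Preadditive.sum_comp]
    _ = _ := by rw [this]; simp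

/-- The trace is cyclic. -/
theorem tr_comp_comm {X Y : C} (f : X ⟶ Y) (g : Y ⟶ X) : tr (f ≫ g) = tr (g ≫ f) := by
  obtain ⟨D⟩ := nonempty_simpleDecomposition Y
  have := D.simple
  calc tr (f ≫ g) = tr (f ≫ (∑ i, D.π i ≫ D.incl i) ≫ g) := by rw [D.total, Category.id_comp]
    _ = ∑ i, tr ((f ≫ D.π i) ≫ (D.incl i ≫ g)) := by
        rw [Preadditive.sum_comp, Preadditive.comp_sum, tr_sum]; simp
    _ = ∑ i, tr ((g ≫ f ≫ D.π i) ≫ D.incl i) := by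
        refine Finset.sum_congr rfl fun i _ => ?_
        rw [tr_comp_comm_of_simple (f ≫ D.π i), tr_comp_comm_of_simple (g ≫ f ≫ D.π i)]
        simp
    _ = tr ((g ≫ f) ≫ ∑ i, D.π i ≫ D.incl i) := by
        rw [Preadditive.comp_sum, tr_sum]; simp
    _ = _ := by rw [D.total, Category.comp_id]

end Trace

end Fusion

/-! ### Tensor products of pairings, partial traces and multiplicativity of the trace. -/

section TensorPairing

variable {C : Type u} [Category.{v} C] [MonoidalCategory C]

theorem tensor_coevaluation_eq (A A' X X' : C) [ExactPairing A A'] [ExactPairing X X'] :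
    η_ (A ⊗ X) (X' ⊗ A') = η_ A A' ≫ A ◁ ((λ_ A').inv ≫ η_ X X' ▷ A' ≫ (α_ X X' A').hom) ≫
      (α_ A X (X' ⊗ A')).inv := by
  rw [ExactPairing.tensor_coevaluation]
  monoidal

theorem tensor_evaluation_eq (A A' X X' : C) [ExactPairing A A'] [ExactPairing X X'] :
    ε_ (A ⊗ X) (X' ⊗ A') = (α_ X' A' (A ⊗ X)).hom ≫
      X' ◁ ((α_ A' A X).inv ≫ ε_ A A' ▷ X ≫ (λ_ X).hom) ≫ ε_ X X' := by
  rw [ExactPairing.tensor_evaluation]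
  monoidal

end TensorPairing

section Fusion

variable {C : Type u} [Category.{v} C] [Abelian C] [Linear ℂ C]
  [MonoidalCategory C] [MonoidalPreadditive C] [MonoidalLinear ℂ C] [RightRigidCategory C]
  [UnitaryFusionCategory C]

section PartialTrace

/-- Close the left strand of a morphism `A ⊗ X ⟶ A ⊗ Y`. -/
def leftPartialTrace (A A' X : C) [ExactPairing A A'] {Y : C} (F : A ⊗ X ⟶ A ⊗ Y) : X ⟶ Y :=
  (λ_ X).inv ≫ dag (ε_ A A') ▷ X ≫ (α_ A' A X).hom ≫ A' ◁ F ≫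
    (α_ A' A Y).inv ≫ ε_ A A' ▷ Y ≫ (λ_ Y).hom

/-- Close the right strand of an endomorphism of `A ⊗ X`. -/
def rightPartialTrace (A X X' : C) [ExactPairing X X'] (F : A ⊗ X ⟶ A ⊗ X) : A ⟶ A :=
  (ρ_ A).inv ≫ A ◁ η_ X X' ≫ (α_ A X X').inv ≫ F ▷ X' ≫
    (α_ A X X').hom ≫ A ◁ dag (η_ X X') ≫ (ρ_ A).hom

theorem whiskerLeft_leftPartialTrace (A A' : C) {X Y Z : C} [ExactPairing A A']
    (g : X ⟶ Y) (F : A ⊗ Y ⟶ A ⊗ Z) :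
    leftPartialTrace A A' X (A ◁ g ≫ F) = g ≫ leftPartialTrace A A' Y F := by
  have h1 : g ≫ (λ_ Y).inv ≫ dag (ε_ A A') ▷ Y ≫ (α_ A' A Y).hom =
      (λ_ X).inv ≫ dag (ε_ A A') ▷ X ≫ (α_ A' A X).hom ≫ A' ◁ A ◁ g := by
    rw [leftUnitor_inv_naturality_assoc, whisker_exchange_assoc]; simp
  simp only [leftPartialTrace, MonoidalCategory.whiskerLeft_comp, Category.assoc]
  rw [reassoc_of% h1]

theorem leftPartialTrace_whiskerLeft (A A' : C) {X Y Z : C} [ExactPairing A A']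
    (F : A ⊗ X ⟶ A ⊗ Y) (h : Y ⟶ Z) :
    leftPartialTrace A A' X (F ≫ A ◁ h) = leftPartialTrace A A' X F ≫ h := by
  have h2 : (α_ A' A Y).inv ≫ ε_ A A' ▷ Y ≫ (λ_ Y).hom ≫ h =
      A' ◁ A ◁ h ≫ (α_ A' A Z).inv ≫ ε_ A A' ▷ Z ≫ (λ_ Z).hom := by
    rw [← leftUnitor_naturality, ← whisker_exchange_assoc]; simp
  simp only [leftPartialTrace, MonoidalCategory.whiskerLeft_comp, Category.assoc, h2]

theorem leftPartialTrace_id (A X : C) :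
    leftPartialTrace A Aᘁ X (𝟙 (A ⊗ X)) = (qdim A : ℂ) • 𝟙 X := by
  have h : dag (ε_ A Aᘁ) ≫ ε_ A Aᘁ = (qdim A : ℂ) • 𝟙 (𝟙_ C) := by
    rw [← tr_id, tr, isSpherical_rightDual A, scalar_smul_id]
    simp
  calc _ = (λ_ X).inv ≫ (dag (ε_ A Aᘁ) ≫ ε_ A Aᘁ) ▷ X ≫ (λ_ X).hom := by
        simp [leftPartialTrace]
    _ = _ := by
        rw [h, MonoidalLinear.smul_whiskerRight, Linear.smul_comp, Linear.comp_smul, id_whiskerRight,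
          Category.id_comp, Iso.inv_hom_id]

theorem leftPartialTrace_whiskerRight (A A' X : C) [ExactPairing A A'] (F : A ⊗ X ⟶ A ⊗ X) (Y : C) :
    leftPartialTrace A A' (X ⊗ Y) ((α_ A X Y).inv ≫ F ▷ Y ≫ (α_ A X Y).hom) =
      leftPartialTrace A A' X F ▷ Y := by
  simp only [leftPartialTrace]
  monoidal

variable (A A' X X' : C) [ExactPairing A A'] [ExactPairing X X'] (F : A ⊗ X ⟶ A ⊗ X)

theorem loop_tensor_eq_rightPartialTrace :
    η_ (A ⊗ X) (X' ⊗ A') ≫ F ▷ (X' ⊗ A') ≫ dag (η_ (A ⊗ X) (X' ⊗ A')) =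
      η_ A A' ≫ rightPartialTrace A X X' F ▷ A' ≫ dag (η_ A A') := by
  rw [tensor_coevaluation_eq, rightPartialTrace]
  simp only [dag_comp, dag_whiskerLeft, dag_whiskerRight, dag_associator_inv, dag_leftUnitor_inv,
    UnitaryFusionCategory.dag_associator]
  monoidal

theorem dual_loop_tensor_eq_leftPartialTrace :
    dag (ε_ (A ⊗ X) (X' ⊗ A')) ≫ (X' ⊗ A') ◁ F ≫ ε_ (A ⊗ X) (X' ⊗ A') =
      dag (ε_ X X') ≫ X' ◁ leftPartialTrace A A' X F ≫ ε_ X X' := by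
  rw [tensor_evaluation_eq, leftPartialTrace]
  simp only [dag_comp, dag_whiskerLeft, dag_whiskerRight, dag_associator_inv,
    UnitaryFusionCategory.dag_leftUnitor, UnitaryFusionCategory.dag_associator]
  monoidal

theorem dual_loop_rightPartialTrace :
    dag (ε_ A A') ≫ A' ◁ rightPartialTrace A X X' F ≫ ε_ A A' =
      η_ X X' ≫ leftPartialTrace A A' X F ▷ X' ≫ dag (η_ X X') := by
  calc _ = (ρ_ (𝟙_ C)).inv ≫ (dag (ε_ A A') ▷ 𝟙_ C ≫ (A' ⊗ A) ◁ η_ X X') ⊗≫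
        A' ◁ F ▷ X' ⊗≫ ((A' ⊗ A) ◁ dag (η_ X X') ≫ ε_ A A' ▷ 𝟙_ C) ≫ (ρ_ (𝟙_ C)).hom := by
        rw [rightPartialTrace]; monoidal
    -- Interchange law: with `A` closed on the left and `X` on the right, either strand may be
    -- closed first.
    _ = (ρ_ (𝟙_ C)).inv ≫ (𝟙_ C ◁ η_ X X' ≫ dag (ε_ A A') ▷ (X ⊗ X')) ⊗≫
        A' ◁ F ▷ X' ⊗≫ (ε_ A A' ▷ (X ⊗ X') ≫ 𝟙_ C ◁ dag (η_ X X')) ≫ (ρ_ (𝟙_ C)).hom := by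
      rw [← whisker_exchange, whisker_exchange (ε_ A A') (dag (η_ X X'))]
    _ = _ := by rw [leftPartialTrace]; monoidal

variable {A A' X X'}

/-- Pass from the right closure to the left one strand at a time. This lets traces on `A ⊗ X` be
computed with the nested pairing instead of the chosen dual. -/
theorem IsSpherical.tensor (hA : IsSpherical A A') (hX : IsSpherical X X') :
    IsSpherical (A ⊗ X) (X' ⊗ A') := by
  intro F
  rw [loop_tensor_eq_rightPartialTrace, hA, dual_loop_rightPartialTrace, hX,
    dual_loop_tensor_eq_leftPartialTrace]

variable (A X) in
theorem tr_tensor (F : A ⊗ X ⟶ A ⊗ X) : tr F = tr (leftPartialTrace A Aᘁ X F) := by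
  rw [tr_eq_loop (X' := Xᘁ ⊗ Aᘁ) F ((isSpherical_rightDual A).tensor (isSpherical_rightDual X)),
    loop_apply, loop_tensor_eq_rightPartialTrace, isSpherical_rightDual A,
    dual_loop_rightPartialTrace, tr]

theorem qdim_tensor (A X : C) : qdim (A ⊗ X) = qdim A * qdim X := by
  have h := tr_tensor A X (𝟙 (A ⊗ X))
  rw [leftPartialTrace_id, tr_smul, tr_id, tr_id] at h
  exact_mod_cast h

/-- The pairing of a dual object with the object, given by the adjoints of the cup and the cap. -/
abbrev dagPairing (X X' : C) [ExactPairing X X'] : ExactPairing X' X where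
  coevaluation' := dag (ε_ X X')
  evaluation' := dag (η_ X X')
  coevaluation_evaluation' := by
    apply dag_injective
    simp only [dag_comp, dag_whiskerLeft, dag_whiskerRight, dag_associator_inv,
      dag_leftUnitor_inv, UnitaryFusionCategory.dag_rightUnitor, dag_dag, Category.assoc]
    exact ExactPairing.evaluation_coevaluation X X'
  evaluation_coevaluation' := by
    apply dag_injective
    simp only [dag_comp, dag_whiskerLeft, dag_whiskerRight, UnitaryFusionCategory.dag_associator,
      dag_rightUnitor_inv, UnitaryFusionCategory.dag_leftUnitor, dag_dag, Category.assoc]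
    exact ExactPairing.coevaluation_evaluation X X'

theorem qdim_rightDual (X : C) : qdim Xᘁ = qdim X := by
  let := dagPairing X Xᘁ
  have hs : IsSpherical Xᘁ X := fun F =>
    scalar_injective (by
      have h := (isSpherical_rightDual X).dualLoop_eq F
      rw [dualLoop_apply] at h
      change scalar (dag (ε_ X Xᘁ) ≫ F ▷ X ≫ dag (dag (ε_ X Xᘁ))) =
        scalar (dag (dag (η_ X Xᘁ)) ≫ X ◁ F ≫ dag (η_ X Xᘁ))
      rw [dag_dag, dag_dag, ← h])
  have h1 := tr_eq_loop (𝟙 Xᘁ) hs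
  have h2 : loop Xᘁ X (𝟙 Xᘁ) = tr (𝟙 X) := by
    change scalar (dag (ε_ X Xᘁ) ≫ 𝟙 Xᘁ ▷ X ≫ dag (dag (ε_ X Xᘁ))) = _
    rw [tr, isSpherical_rightDual X, dag_dag]
    simp
  rw [h2, tr_id, tr_id] at h1
  exact_mod_cast h1

/-- The double dual of an object is isomorphic to it. -/
theorem nonempty_iso_rightDual_rightDual (X : C) : Nonempty (((Xᘁ : C)ᘁ : C) ≅ X) :=
  ⟨rightDualIso (HasRightDual.exact (X := HasRightDual.rightDual X)) (dagPairing X Xᘁ)⟩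

end PartialTrace

end Fusion

/-! ### Naturality and hexagon identities for the double braiding. -/

section DoubleBraiding

variable {C : Type u} [Category.{v} C] [MonoidalCategory C] [BraidedCategory C]

theorem whiskerRight_doubleBraiding {X Y : C} (f : X ⟶ Y) (Z : C) :
    f ▷ Z ≫ doubleBraiding Y Z = doubleBraiding X Z ≫ f ▷ Z := by
  simp [doubleBraiding]

theorem whiskerLeft_doubleBraiding (Z : C) {X Y : C} (f : X ⟶ Y) :
    Z ◁ f ≫ doubleBraiding Z Y = doubleBraiding Z X ≫ Z ◁ f := by
  simp [doubleBraiding]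

theorem doubleBraiding_unit (X : C) : doubleBraiding (𝟙_ C) X = 𝟙 _ := by
  simp [doubleBraiding]

theorem doubleBraiding_tensor (A B X : C) : doubleBraiding (A ⊗ B) X =
    (α_ A B X).hom ≫ (A ◁ (β_ B X).hom ≫
      ((α_ A X B).inv ≫ doubleBraiding A X ▷ B ≫ (α_ A X B).hom) ≫ A ◁ (β_ X B).hom) ≫
      (α_ A B X).inv := by
  simp [doubleBraiding, BraidedCategory.braiding_tensor_left_hom,
    BraidedCategory.braiding_tensor_right_hom]

theorem doubleBraiding_eq_id_comm {X Y : C} (h : doubleBraiding X Y = 𝟙 _) :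
    doubleBraiding Y X = 𝟙 _ := by
  rw [doubleBraiding] at h ⊢
  rw [← cancel_epi (β_ X Y).hom, ← Category.assoc, h]
  simp

end DoubleBraiding

section Fusion

variable {C : Type u} [Category.{v} C] [Abelian C] [Linear ℂ C]
  [MonoidalCategory C] [MonoidalPreadditive C] [MonoidalLinear ℂ C] [RightRigidCategory C]
  [UnitaryFusionCategory C]

/-! ### Multiplicities, Frobenius reciprocity and additivity of dimension. -/

section Multiplicity

variable {X : C} (D : SimpleDecomposition X)

namespace SimpleDecomposition

/-- Morphisms out of an object, in terms of its summands. -/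
def homEquiv (W : C) : (X ⟶ W) ≃ₗ[ℂ] (∀ i, D.summand i ⟶ W) where
  toFun f i := D.incl i ≫ f
  map_add' f g := by ext; simp
  map_smul' c f := by ext; simp
  invFun g := ∑ i, D.π i ≫ g i
  left_inv f := by
    simp only [← Category.assoc]
    rw [← Preadditive.sum_comp, D.total, Category.id_comp]
  right_inv g := by
    ext i
    change D.incl i ≫ (∑ j, D.π j ≫ g j) = g i
    rw [Preadditive.comp_sum, Finset.sum_eq_single i]
    · rw [← Category.assoc, D.incl_π_self, Category.id_comp]
    · intro j _ hj
      rw [← Category.assoc, D.incl_π_ne i j hj.symm, zero_comp]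
    · simp

/-- Morphisms into an object, in terms of its summands. -/
def homEquiv' (W : C) : (W ⟶ X) ≃ₗ[ℂ] (∀ i, W ⟶ D.summand i) where
  toFun f i := f ≫ D.π i
  map_add' f g := by ext; simp
  map_smul' c f := by ext; simp
  invFun g := ∑ i, g i ≫ D.incl i
  left_inv f := by
    simp only [Category.assoc]
    rw [← Preadditive.comp_sum, D.total, Category.comp_id]
  right_inv g := by
    ext i
    change (∑ j, g j ≫ D.incl j) ≫ D.π i = g i
    rw [Preadditive.sum_comp, Finset.sum_eq_single i]
    · rw [Category.assoc, D.incl_π_self, Category.comp_id]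
    · intro j _ hj
      rw [Category.assoc, D.incl_π_ne j i hj, comp_zero]
    · simp

open scoped Classical in
theorem finrank_hom (W : C) [Simple W] : Module.finrank ℂ (X ⟶ W) =
    ∑ i, if Nonempty (D.summand i ≅ W) then 1 else 0 := by
  have := D.simple
  rw [(D.homEquiv W).finrank_eq, Module.finrank_pi_fintype]
  exact Finset.sum_congr rfl fun i _ => finrank_hom_simple_simple ℂ _ _

open scoped Classical in
theorem finrank_hom' (W : C) [Simple W] : Module.finrank ℂ (W ⟶ X) =
    ∑ i, if Nonempty (D.summand i ≅ W) then 1 else 0 := by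
  have := D.simple
  rw [(D.homEquiv' W).finrank_eq, Module.finrank_pi_fintype]
  refine Finset.sum_congr rfl fun i _ => (finrank_hom_simple_simple ℂ _ _).trans ?_
  congr 1
  exact propext ⟨fun ⟨e⟩ => ⟨e.symm⟩, fun ⟨e⟩ => ⟨e.symm⟩⟩

end SimpleDecomposition

theorem finrank_hom_comm (X W : C) [Simple W] :
    Module.finrank ℂ (X ⟶ W) = Module.finrank ℂ (W ⟶ X) := by
  obtain ⟨D⟩ := nonempty_simpleDecomposition X
  rw [D.finrank_hom, D.finrank_hom']

/-- An additive isomorphism invariant is determined by its values on the simple objects. -/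
theorem additive_eq_sum {ι : Type*} [Fintype ι] {S : ι → C} (hS : IsSimpleSkeleton S) (φ : C → ℂ)
    (hiso : ∀ {X Y : C}, (X ≅ Y) → φ X = φ Y)
    (hadd : ∀ (X : C) (D : SimpleDecomposition X), φ X = ∑ i, φ (D.summand i)) (X : C) :
    φ X = ∑ c, (Module.finrank ℂ (X ⟶ S c) : ℂ) * φ (S c) := by
  classical
  obtain ⟨D⟩ := nonempty_simpleDecomposition X
  have := hS.simple
  choose k hk using fun i => hS.exists_iso _ (D.simple i)
  have hk' : ∀ i c, Nonempty (D.summand i ≅ S c) ↔ k i = c := by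
    refine fun i c => ⟨fun ⟨e⟩ => hS.eq_of_iso _ _ ?_, fun h => h ▸ hk i⟩
    obtain ⟨e'⟩ := hk i
    exact ⟨e'.symm ≪≫ e⟩
  rw [hadd X D]
  simp only [D.finrank_hom, hk', Nat.cast_sum, Nat.cast_ite, Nat.cast_one, Nat.cast_zero,
    Finset.sum_mul, ite_mul, one_mul, zero_mul]
  rw [Finset.sum_comm]
  refine Finset.sum_congr rfl fun i _ => ?_
  obtain ⟨e⟩ := hk i
  simp [hiso e]

/-- Bending `b` turns Hom(c, b ⊗ a) into Hom(b* ⊗ c, a). Semisimplicity is used to reverse the arrow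
first. -/
theorem finrank_frobenius (b c a : C) [Simple c] :
    Module.finrank ℂ (b ⊗ a ⟶ c) = Module.finrank ℂ (bᘁ ⊗ c ⟶ a) := by
  rw [finrank_hom_comm]
  symm
  refine LinearEquiv.finrank_eq
    { tensorLeftHomEquiv c b bᘁ a with
      map_add' := fun f g => ?_
      map_smul' := fun z f => ?_ }
  · simp [tensorLeftHomEquiv, MonoidalPreadditive.whiskerLeft_add]
  · simp [tensorLeftHomEquiv]

theorem qdim_congr {X Y : C} (e : X ≅ Y) : qdim X = qdim Y := by
  have h := tr_comp_comm e.hom e.inv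
  rw [e.hom_inv_id, e.inv_hom_id, tr_id, tr_id] at h
  exact_mod_cast h

theorem qdim_eq_sum (X : C) (D : SimpleDecomposition X) :
    (qdim X : ℂ) = ∑ i, (qdim (D.summand i) : ℂ) := by
  rw [← tr_id, ← D.total, tr_sum]
  exact Finset.sum_congr rfl fun i _ => by rw [tr_comp_comm, D.incl_π_self, tr_id]

end Multiplicity

/-! ### Encircling loops and the characters a ↦ tr B_{a,z}. -/

section Braided

variable [BraidedCategory C]

theorem doubleBraiding_comp_dag [IsPremodular C] (X Y : C) :
    doubleBraiding X Y ≫ dag (doubleBraiding X Y) = 𝟙 _ := by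
  simp [doubleBraiding, dag_comp, IsPremodular.dag_braiding]

theorem encircle_eq (A X : C) : encircle A X = leftPartialTrace A Aᘁ X (doubleBraiding A X) := rfl

theorem comp_encircle (A : C) {X Y : C} (f : X ⟶ Y) :
    f ≫ encircle A Y = encircle A X ≫ f := by
  rw [encircle_eq, encircle_eq, ← whiskerLeft_leftPartialTrace, whiskerLeft_doubleBraiding,
    leftPartialTrace_whiskerLeft]

theorem encircle_eq_smul (A z : C) [Simple z] :
    encircle A z = (tr (doubleBraiding A z) / qdim z) • 𝟙 z := by
  obtain ⟨l, hl⟩ := endomorphism_simple_eq_smul_id ℂ (encircle A z)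
  have hz : (qdim z : ℂ) ≠ 0 := by exact_mod_cast (qdim_pos z).ne'
  rw [tr_tensor, ← encircle_eq, ← hl, tr_smul, tr_id, mul_div_cancel_right₀ _ hz]

theorem tr_doubleBraiding_congr_left {X Y : C} (e : X ≅ Y) (z : C) :
    tr (doubleBraiding X z) = tr (doubleBraiding Y z) := by
  have h := tr_comp_comm (e.hom ▷ z ≫ doubleBraiding Y z) (e.inv ▷ z)
  rw [whiskerRight_doubleBraiding, Category.assoc, ← whiskerRight_doubleBraiding] at h
  simpa using h

theorem tr_doubleBraiding_congr_right (X : C) {z w : C} (e : z ≅ w) :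
    tr (doubleBraiding X z) = tr (doubleBraiding X w) := by
  have h := tr_comp_comm (X ◁ e.hom ≫ doubleBraiding X w) (X ◁ e.inv)
  rw [whiskerLeft_doubleBraiding, Category.assoc, ← whiskerLeft_doubleBraiding] at h
  simpa using h

theorem tr_doubleBraiding_eq_sum (z X : C) (D : SimpleDecomposition X) :
    tr (doubleBraiding X z) = ∑ i, tr (doubleBraiding (D.summand i) z) := by
  calc _ = tr ((∑ i, D.π i ≫ D.incl i) ▷ z ≫ doubleBraiding X z) := by rw [D.total]; simp
    _ = ∑ i, tr (D.π i ▷ z ≫ (doubleBraiding (D.summand i) z ≫ D.incl i ▷ z)) := by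
        simp only [← whiskerRight_doubleBraiding]
        rw [sum_whiskerRight, Preadditive.sum_comp, tr_sum]
        simp
    _ = _ := by
        refine Finset.sum_congr rfl fun i _ => ?_
        rw [tr_comp_comm, Category.assoc, ← comp_whiskerRight, D.incl_π_self, id_whiskerRight,
          Category.comp_id]

/-- By the hexagon, `A` loops around `z` inside the loop of `B`. Closing `A` first leaves a scalar
on the simple `z`, and what remains is the double braiding of `B` with `z`. -/
theorem tr_doubleBraiding_tensor (A B z : C) [Simple z] :
    tr (doubleBraiding (A ⊗ B) z) * qdim z =
      tr (doubleBraiding A z) * tr (doubleBraiding B z) := by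
  have hz : (qdim z : ℂ) ≠ 0 := by exact_mod_cast (qdim_pos z).ne'
  rw [doubleBraiding_tensor, tr_comp_comm, Category.assoc, Iso.inv_hom_id, Category.comp_id,
    tr_tensor, whiskerLeft_leftPartialTrace, leftPartialTrace_whiskerLeft,
    leftPartialTrace_whiskerRight, ← encircle_eq, encircle_eq_smul]
  simp only [MonoidalLinear.smul_whiskerRight, id_whiskerRight, Linear.smul_comp,
    Linear.comp_smul, Category.id_comp, tr_smul]
  rw [← doubleBraiding]
  field_simp

theorem mugerCenter_of_simples {ι : Type*} {S : ι → C} (hS : IsSimpleSkeleton S) {z : C}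
    (h : ∀ b, doubleBraiding (S b) z = 𝟙 _) : mugerCenter z := by
  intro X
  apply doubleBraiding_eq_id_comm
  obtain ⟨D⟩ := nonempty_simpleDecomposition X
  have key : ∀ i, doubleBraiding (D.summand i) z = 𝟙 _ := by
    intro i
    obtain ⟨b, ⟨e⟩⟩ := hS.exists_iso _ (D.simple i)
    rw [← cancel_mono (e.hom ▷ z), ← whiskerRight_doubleBraiding, h]
    simp
  calc doubleBraiding X z = (∑ i, D.π i ≫ D.incl i) ▷ z ≫ doubleBraiding X z := by
        rw [D.total]; simp
    _ = (∑ i, D.π i ≫ D.incl i) ▷ z := by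
        rw [sum_whiskerRight, Preadditive.sum_comp]
        refine Finset.sum_congr rfl fun i _ => ?_
        rw [comp_whiskerRight, Category.assoc, whiskerRight_doubleBraiding, key, Category.id_comp]
    _ = _ := by rw [D.total]; simp

variable {ι : Type*} [Fintype ι] {S : ι → C}

/-- The weighted sum of the loops around a simple object is an eigenvector of every loop. -/
theorem tr_doubleBraiding_mul_sum (hS : IsSimpleSkeleton S) (b z : C) [Simple z] :
    tr (doubleBraiding b z) * ∑ a, qdim (S a) * tr (doubleBraiding (S a) z) =
      (qdim b * qdim z) * ∑ a, qdim (S a) * tr (doubleBraiding (S a) z) := by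
  have := hS.simple
  calc _ = ∑ a, qdim (S a) * (tr (doubleBraiding (b ⊗ S a) z) * qdim z) := by
        rw [Finset.mul_sum]
        refine Finset.sum_congr rfl fun a _ => ?_
        rw [tr_doubleBraiding_tensor]; ring
    _ = ∑ a, ∑ c, qdim z * tr (doubleBraiding (S c) z) *
          ((Module.finrank ℂ ((bᘁ : C) ⊗ S c ⟶ S a) : ℂ) * qdim (S a)) := by
        refine Finset.sum_congr rfl fun a _ => ?_
        rw [additive_eq_sum hS (fun X => tr (doubleBraiding X z))
          (fun e => tr_doubleBraiding_congr_left e z) (fun X D => tr_doubleBraiding_eq_sum z X D)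
          (b ⊗ S a), Finset.sum_mul, Finset.mul_sum]
        refine Finset.sum_congr rfl fun c _ => ?_
        -- Moving `b` across the multiplicity makes the sum over `a` compute the dimension of b* ⊗
        -- c.
        rw [finrank_frobenius]; ring
    _ = ∑ c, qdim z * tr (doubleBraiding (S c) z) * qdim ((bᘁ : C) ⊗ S c) := by
        rw [Finset.sum_comm]
        refine Finset.sum_congr rfl fun c _ => ?_
        rw [← Finset.mul_sum, additive_eq_sum hS (fun X => (qdim X : ℂ))
          (fun e => by rw [qdim_congr e]) qdim_eq_sum ((bᘁ : C) ⊗ S c)]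
    _ = _ := by
        rw [Finset.mul_sum]
        refine Finset.sum_congr rfl fun c _ => ?_
        rw [qdim_tensor, qdim_rightDual]; push_cast; ring

/-- For unitary B, tr((1 − B)(1 − B)†) = 2 tr 1 − 2 Re tr B, which vanishes here; the trace is
faithful. -/
theorem doubleBraiding_eq_id_of_tr [IsPremodular C] {X Y : C}
    (h : tr (doubleBraiding X Y) = tr (𝟙 (X ⊗ Y))) : doubleBraiding X Y = 𝟙 _ := by
  refine (sub_eq_zero.1 (eq_zero_of_tr_comp_dag (𝟙 _ - doubleBraiding X Y) ?_)).symm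
  rw [dag_sub, dag_id, Preadditive.sub_comp, Preadditive.comp_sub, Preadditive.comp_sub,
    doubleBraiding_comp_dag]
  simp only [Category.comp_id, Category.id_comp, tr_sub, tr_dag, h, tr_id, Complex.conj_ofReal]
  simp

/-- A nonzero sum could be cancelled from the eigenvector relation, so every double braiding with
`z` would have the trace of the identity and thus be trivial. -/
theorem sum_tr_doubleBraiding_of_not_mugerCenter [IsPremodular C] (hS : IsSimpleSkeleton S)
    {z : C} [Simple z] (hz : ¬ mugerCenter z) :
    ∑ a, qdim (S a) * tr (doubleBraiding (S a) z) = 0 := by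
  by_contra hs
  refine hz (mugerCenter_of_simples hS fun b => doubleBraiding_eq_id_of_tr ?_)
  rw [mul_right_cancel₀ hs (tr_doubleBraiding_mul_sum hS (S b) z), tr_id, qdim_tensor]
  push_cast; rfl

theorem sum_tr_doubleBraiding_of_mugerCenter {z : C} (hz : mugerCenter z) :
    ∑ a, qdim (S a) * tr (doubleBraiding (S a) z) =
      ((∑ a, qdim (S a) ^ 2 : ℝ) : ℂ) * qdim z := by
  push_cast
  rw [Finset.sum_mul]
  refine Finset.sum_congr rfl fun a _ => ?_
  rw [doubleBraiding_eq_id_comm (hz (S a)), tr_id, qdim_tensor]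
  push_cast; ring

end Braided

/-! ### The total dimension and the resolution of the identity by fusion vertices. -/

theorem totalDim_sq {ι : Type*} [Fintype ι] (S : ι → C) :
    totalDim S ^ 2 = ∑ a, qdim (S a) ^ 2 :=
  Real.sq_sqrt (Finset.sum_nonneg fun _ _ => sq_nonneg _)

theorem totalDim_ne_zero {ι : Type*} [Fintype ι] {S : ι → C} (hS : IsSimpleSkeleton S) :
    totalDim S ≠ 0 := by
  have := hS.simple
  obtain ⟨i, -⟩ := hS.exists_iso (𝟙_ C) inferInstance
  refine (Real.sqrt_pos.2 ?_).ne'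
  exact Finset.sum_pos (fun a _ => pow_pos (qdim_pos (S a)) 2) ⟨i, Finset.mem_univ i⟩

/-- A normalized basis of the fusion spaces resolves the identity. -/
theorem sum_normalized_eq_id {ι : Type*} [Fintype ι] {S : ι → C} (hS : IsSimpleSkeleton S)
    {X Y : C} [Simple X] [Simple Y] {κ : ι → Type*} [∀ z, Fintype (κ z)]
    (v : ∀ z, Module.Basis (κ z) ℂ (X ⊗ Y ⟶ S z)) (hv : IsNormalized S X Y v) :
    ∑ z, ∑ μ, (Real.sqrt (qdim (S z) / (qdim X * qdim Y)) : ℂ) • (v z μ ≫ dag (v z μ)) =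
      𝟙 (X ⊗ Y) := by
  classical
  have := hS.simple
  set E := ∑ z, ∑ μ, (Real.sqrt (qdim (S z) / (qdim X * qdim Y)) : ℂ) •
    (v z μ ≫ dag (v z μ)) with hE
  -- It suffices that `E` fixes the basis vectors: it then fixes every morphism to a simple object,
  -- in particular the projections of a decomposition of X ⊗ Y. Channels z ≠ w drop out by Schur's
  -- lemma.
  have hbasis : ∀ w (μ : κ w), E ≫ v w μ = v w μ := by
    intro w μ
    rw [hE, Preadditive.sum_comp, Finset.sum_eq_single w]
    · rw [Preadditive.sum_comp, Finset.sum_eq_single μ]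
      · rw [Linear.smul_comp, Category.assoc, (hv w).1, Linear.comp_smul, smul_smul,
          Category.comp_id, ← Complex.ofReal_mul, ← Real.sqrt_mul (by
            exact (div_pos (qdim_pos _) (mul_pos (qdim_pos _) (qdim_pos _))).le)]
        have h1 := (qdim_pos X).ne'
        have h2 := (qdim_pos Y).ne'
        have h3 := (qdim_pos (S w)).ne'
        rw [show qdim (S w) / (qdim X * qdim Y) * (qdim X * qdim Y / qdim (S w)) = 1 by
          field_simp]
        simp
      · intro ν _ hν
        rw [Linear.smul_comp, Category.assoc, (hv w).2 ν μ hν, comp_zero, smul_zero]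
      · simp
    · intro z _ hz
      rw [Preadditive.sum_comp]
      refine Finset.sum_eq_zero fun ν _ => ?_
      have h0 : dag (v z ν) ≫ v w μ = 0 := by
        by_contra hne
        have := isIso_of_hom_simple hne
        exact hz (hS.eq_of_iso z w ⟨asIso (dag (v z ν) ≫ v w μ)⟩)
      rw [Linear.smul_comp, Category.assoc, h0, comp_zero, smul_zero]
    · simp
  have hhom : ∀ w (f : X ⊗ Y ⟶ S w), E ≫ f = f := by
    intro w f
    rw [← (v w).sum_repr f, Preadditive.comp_sum]
    exact Finset.sum_congr rfl fun μ _ => by rw [Linear.comp_smul, hbasis]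
  obtain ⟨D⟩ := nonempty_simpleDecomposition (X ⊗ Y)
  have hπ : ∀ i, E ≫ D.π i = D.π i := by
    intro i
    obtain ⟨w, ⟨e⟩⟩ := hS.exists_iso _ (D.simple i)
    rw [← cancel_mono e.hom, Category.assoc, hhom]
  calc E = E ≫ ∑ i, D.π i ≫ D.incl i := by rw [D.total, Category.comp_id]
    _ = ∑ i, D.π i ≫ D.incl i := by
        rw [Preadditive.comp_sum]
        exact Finset.sum_congr rfl fun i _ => by rw [← Category.assoc, hπ]
    _ = _ := D.total

end Fusion
end Premodular

/-! ### The main theorem. -/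

open Premodular CStarCategory in
open scoped Classical in
theorem mainTheorem3 {C : Type u} [Category.{v} C] [Abelian C] [Linear ℂ C]
    [MonoidalCategory C] [MonoidalPreadditive C] [MonoidalLinear ℂ C] [RightRigidCategory C]
    [UnitaryFusionCategory C] [BraidedCategory C] [IsPremodular C]
    {ι : Type*} [Fintype ι] (S : ι → C) (hS : IsSimpleSkeleton S) :
    (∀ a b : ι,
      encircle (S a) (S b) =
        (sMatrix S (S a) (S b)ᘁ / sMatrix S (𝟙_ C) (S b)ᘁ) • 𝟙 (S b) ∧
      sMatrix S (S a) (S b)ᘁ / sMatrix S (𝟙_ C) (S b)ᘁ =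
        (totalDim S : ℂ) * sMatrix S (S a) (S b)ᘁ / (qdim (S b) : ℂ)) ∧
    (∀ (x y : ι) (κ : ι → Type*) [∀ z, Fintype (κ z)]
      (v : ∀ z, Module.Basis (κ z) ℂ (S x ⊗ S y ⟶ S z)), IsNormalized S (S x) (S y) v →
      (1 / (totalDim S : ℂ) ^ 2) • ∑ a, (qdim (S a) : ℂ) • encircle (S a) (S x ⊗ S y) =
        ∑ z with mugerCenter (S z), ∑ μ,
          (Real.sqrt (qdim (S z) / (qdim (S x) * qdim (S y))) : ℂ) •
            (v z μ ≫ dag (v z μ))) := by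
  have := hS.simple
  have hD : (totalDim S : ℂ) ≠ 0 := by exact_mod_cast totalDim_ne_zero hS
  constructor
  · intro a b
    have hb : (qdim (S b) : ℂ) ≠ 0 := by exact_mod_cast (qdim_pos (S b)).ne'
    -- `sMatrix` dualises its second argument, so with `(S b)ᘁ` there the double dual of `S b`
    -- appears.
    obtain ⟨e⟩ := nonempty_iso_rightDual_rightDual (S b)
    have h1 : sMatrix S (𝟙_ C) (S b)ᘁ = 1 / (totalDim S : ℂ) * qdim (S b) := by
      rw [sMatrix, tr_doubleBraiding_congr_right _ e, doubleBraiding_unit, tr_id,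
        qdim_congr (λ_ (S b))]
    have h2 : sMatrix S (S a) (S b)ᘁ =
        1 / (totalDim S : ℂ) * tr (doubleBraiding (S a) (S b)) := by
      rw [sMatrix, tr_doubleBraiding_congr_right _ e]
    rw [h1, h2, encircle_eq_smul]
    refine ⟨?_, ?_⟩
    · congr 1
      field_simp
    · field_simp
  · intro x y κ _ v hv
    -- On a simple strand the averaged loop is the indicator of the Müger center.
    have hz : ∀ z, (1 / (totalDim S : ℂ) ^ 2) • ∑ a, (qdim (S a) : ℂ) • encircle (S a) (S z) =
        if mugerCenter (S z) then 𝟙 (S z) else 0 := by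
      intro z
      have hd : (qdim (S z) : ℂ) ≠ 0 := by exact_mod_cast (qdim_pos (S z)).ne'
      have h1 : ∑ a, (qdim (S a) : ℂ) • encircle (S a) (S z) =
          ((∑ a, qdim (S a) * tr (doubleBraiding (S a) (S z))) / qdim (S z)) • 𝟙 (S z) := by
        rw [Finset.sum_div, Finset.sum_smul]
        refine Finset.sum_congr rfl fun a _ => ?_
        rw [encircle_eq_smul, smul_smul, mul_div_assoc]
      rw [h1]
      split_ifs with hm
      · rw [sum_tr_doubleBraiding_of_mugerCenter hm, ← totalDim_sq, smul_smul, Complex.ofReal_pow,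
          mul_div_cancel_right₀ _ hd, one_div_mul_cancel (pow_ne_zero 2 hD), one_smul]
      · rw [sum_tr_doubleBraiding_of_not_mugerCenter hS hm, zero_div, zero_smul, smul_zero]
    have hnat : ∀ z (f : S x ⊗ S y ⟶ S z),
        f ≫ ((1 / (totalDim S : ℂ) ^ 2) • ∑ a, (qdim (S a) : ℂ) • encircle (S a) (S z)) =
        ((1 / (totalDim S : ℂ) ^ 2) •
          ∑ a, (qdim (S a) : ℂ) • encircle (S a) (S x ⊗ S y)) ≫ f := by
      intro z f
      simp only [Linear.comp_smul, Linear.smul_comp, Preadditive.comp_sum, Preadditive.sum_comp,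
        comp_encircle]
    -- Resolve the identity of x ⊗ y after the averaged loop, so that naturality can move the loop
    -- through each vertex onto the channel `z`.
    rw [← Category.comp_id ((1 / (totalDim S : ℂ) ^ 2) • ∑ a, _), ← sum_normalized_eq_id hS v hv,
      Preadditive.comp_sum, Finset.sum_filter]
    refine Finset.sum_congr rfl fun z _ => ?_
    rw [Preadditive.comp_sum]
    have hterm : ∀ μ, ((1 / (totalDim S : ℂ) ^ 2) •
          ∑ a, (qdim (S a) : ℂ) • encircle (S a) (S x ⊗ S y)) ≫
        ((Real.sqrt (qdim (S z) / (qdim (S x) * qdim (S y))) : ℂ) •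
          (v z μ ≫ dag (v z μ))) =
        (Real.sqrt (qdim (S z) / (qdim (S x) * qdim (S y))) : ℂ) •
          (v z μ ≫ (if mugerCenter (S z) then 𝟙 (S z) else 0) ≫ dag (v z μ)) := by
      intro μ
      rw [← hz, Linear.comp_smul, ← Category.assoc, ← hnat, Category.assoc]
    rw [Finset.sum_congr rfl fun μ _ => hterm μ]
    split_ifs with hm
    · simp
    · simp
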